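/- Consider the complex $4\times4$ matrices $$J_1=\tfrac12\begin{bmatrix}0&1&0&0\\-1&0&0&0\\0&0&0&1\\0&0&-1&0\end{bmatrix},\quad J_2=\tfrac12\begin{bmatrix}0&i&0&0\\i&0&0&0\\0&0&0&i\\0&0&i&0\end{bmatrix},\quad J_3=\tfrac12\begin{bmatrix}i&0&0&0\\0&-i&0&0\\0&0&i&0\\0&0&0&-i\end{bmatrix},$$ $$K_1=\tfrac12\begin{bmatrix}0&0&0&i\\0&0&-i&0\\0&-i&0&0\\i&0&0&0\end{bmatrix},\quad K_2=\tfrac12\begin{bmatrix}0&0&0&1\\0&0&1&0\\0&-1&0&0\\-1&0&0&0\end{bmatrix},\quad K_3=\tfrac12\begin{bmatrix}0&0&-1&0\\0&0&0&1\\1&0&0&0\\0&-1&0&0\end{bmatrix}.$$ Their real span $\mathfrak{ug}$ is a real Lie subalgebra of $\mathfrak{su}(4)$, and $\mathfrak{j}=\operatorname{span}_{\mathbb R}\{J_1,J_2,J_3\}$ is a Lie subalgebra of $\mathfrak{ug}$. Let $UG\subset SU(4)$ be the connected Lie subgroup with Lie algebra $\mathfrak{ug}$, i.e. the subgroup generated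 by $\{\exp X : X\in\mathfrak{ug}\}$, with the matrix topology, and let $SU_J(2)\subset UG$ be the connected Lie subgroup with Lie algebra $\mathfrak{j}$, i.e. the subgroup generated by $\{\exp X: X\in\mathfrak{j}\}$ (which equals $\{\exp X: X\in\mathfrak{j}\}$). **Theorem.** The homogeneous space $UG/SU_J(2)$, with the quotient topology, is simply connected (path-connected with $\pi_1(UG/SU_J(2))=0$). -/

import Mathlib

open NormedSpace

namespace Superspinor

/-- Complex `4 × 4` matrices, with the entrywise (product) topology and the commutator bracket. -/
abbrev Mat4 : Type := Matrix (Fin 4) (Fin 4) ℂ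

attribute [local instance 100] LieRing.ofAssociativeRing

/-! ### The generators -/

/-- The rotation generator `J₁`. -/
noncomputable def J₁ : Mat4 := (1 / 2 : ℂ) •
  !![0, 1, 0, 0; -1, 0, 0, 0; 0, 0, 0, 1; 0, 0, -1, 0]

/-- The rotation generator `J₂`. -/
noncomputable def J₂ : Mat4 := (1 / 2 : ℂ) •
  !![0, Complex.I, 0, 0; Complex.I, 0, 0, 0; 0, 0, 0, Complex.I; 0, 0, Complex.I, 0]

/-- The rotation generator `J₃`. -/
noncomputable def J₃ : Mat4 := (1 / 2 : ℂ) •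
  !![Complex.I, 0, 0, 0; 0, -Complex.I, 0, 0; 0, 0, Complex.I, 0; 0, 0, 0, -Complex.I]

/-- The boost generator `K₁`. -/
noncomputable def K₁ : Mat4 := (1 / 2 : ℂ) •
  !![0, 0, 0, Complex.I; 0, 0, -Complex.I, 0; 0, -Complex.I, 0, 0; Complex.I, 0, 0, 0]

/-- The boost generator `K₂`. -/
noncomputable def K₂ : Mat4 := (1 / 2 : ℂ) •
  !![0, 0, 0, 1; 0, 0, 1, 0; 0, -1, 0, 0; -1, 0, 0, 0]

/-- The boost generator `K₃`. -/
noncomputable def K₃ : Mat4 := (1 / 2 : ℂ) •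
  !![0, 0, -1, 0; 0, 0, 0, 1; 1, 0, 0, 0; 0, -1, 0, 0]

/-! ### Their commutators -/

theorem two_smul_lie {A B C : Mat4} (h : A * B - B * A = (2 : ℂ) • C) :
    ⁅(1 / 2 : ℂ) • A, (1 / 2 : ℂ) • B⁆ = (1 / 2 : ℂ) • C := by
  rw [Ring.lie_def, smul_mul_smul_comm, smul_mul_smul_comm, ← smul_sub, h, smul_smul]
  norm_num [two_mul, sub_eq_add_neg]

theorem lie_J₁_J₂ : ⁅J₁, J₂⁆ = J₃ := by
  refine two_smul_lie ?_
  simp [Matrix.smul_of, Matrix.vecHead, Matrix.vecTail]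
  norm_num [two_mul, sub_eq_add_neg]

theorem lie_J₂_J₃ : ⁅J₂, J₃⁆ = J₁ := by
  refine two_smul_lie ?_
  simp [Matrix.smul_of, Matrix.vecHead, Matrix.vecTail]
  norm_num [two_mul, sub_eq_add_neg]

theorem lie_J₃_J₁ : ⁅J₃, J₁⁆ = J₂ := by
  refine two_smul_lie ?_
  simp [Matrix.smul_of, Matrix.vecHead, Matrix.vecTail]
  norm_num [two_mul, sub_eq_add_neg]

theorem lie_J₁_K₁ : ⁅J₁, K₁⁆ = 0 := by
  rw [← smul_zero (1 / 2 : ℂ)]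
  refine two_smul_lie ?_
  simp [Matrix.vecHead, Matrix.vecTail]

theorem lie_J₁_K₂ : ⁅J₁, K₂⁆ = -K₃ := by
  rw [K₃, ← smul_neg]
  refine two_smul_lie ?_
  simp [Matrix.smul_of, Matrix.vecHead, Matrix.vecTail]
  norm_num [two_mul, sub_eq_add_neg]

theorem lie_J₁_K₃ : ⁅J₁, K₃⁆ = K₂ := by
  refine two_smul_lie ?_
  simp [Matrix.smul_of, Matrix.vecHead, Matrix.vecTail]
  norm_num [two_mul, sub_eq_add_neg]

theorem lie_J₂_K₁ : ⁅J₂, K₁⁆ = -K₃ := by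
  rw [K₃, ← smul_neg]
  refine two_smul_lie ?_
  simp [Matrix.smul_of, Matrix.vecHead, Matrix.vecTail]
  norm_num [two_mul, sub_eq_add_neg]

theorem lie_J₂_K₂ : ⁅J₂, K₂⁆ = 0 := by
  rw [← smul_zero (1 / 2 : ℂ)]
  refine two_smul_lie ?_
  simp [Matrix.vecHead, Matrix.vecTail]

theorem lie_J₂_K₃ : ⁅J₂, K₃⁆ = K₁ := by
  refine two_smul_lie ?_
  simp [Matrix.smul_of, Matrix.vecHead, Matrix.vecTail]
  norm_num [two_mul, sub_eq_add_neg]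

theorem lie_J₃_K₁ : ⁅J₃, K₁⁆ = -K₂ := by
  rw [K₂, ← smul_neg]
  refine two_smul_lie ?_
  simp [Matrix.smul_of, Matrix.vecHead, Matrix.vecTail]
  norm_num [two_mul, sub_eq_add_neg]

theorem lie_J₃_K₂ : ⁅J₃, K₂⁆ = K₁ := by
  refine two_smul_lie ?_
  simp [Matrix.smul_of, Matrix.vecHead, Matrix.vecTail]
  norm_num [two_mul, sub_eq_add_neg]

theorem lie_J₃_K₃ : ⁅J₃, K₃⁆ = 0 := by
  rw [← smul_zero (1 / 2 : ℂ)]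
  refine two_smul_lie ?_
  simp [Matrix.vecHead, Matrix.vecTail]

theorem lie_K₁_K₂ : ⁅K₁, K₂⁆ = -J₃ := by
  rw [J₃, ← smul_neg]
  refine two_smul_lie ?_
  simp [Matrix.smul_of, Matrix.vecHead, Matrix.vecTail]
  norm_num [two_mul, sub_eq_add_neg]

theorem lie_K₂_K₃ : ⁅K₂, K₃⁆ = -J₁ := by
  rw [J₁, ← smul_neg]
  refine two_smul_lie ?_
  simp [Matrix.smul_of, Matrix.vecHead, Matrix.vecTail]
  norm_num [two_mul, sub_eq_add_neg]

theorem lie_K₃_K₁ : ⁅K₃, K₁⁆ = J₂ := by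
  refine two_smul_lie ?_
  simp [Matrix.smul_of, Matrix.vecHead, Matrix.vecTail]
  norm_num [two_mul, sub_eq_add_neg]

theorem lie_mem_span {s : Set Mat4}
    (h : ∀ x ∈ s, ∀ y ∈ s, ⁅x, y⁆ ∈ Submodule.span ℝ s) {x y : Mat4}
    (hx : x ∈ Submodule.span ℝ s) (hy : y ∈ Submodule.span ℝ s) :
    ⁅x, y⁆ ∈ Submodule.span ℝ s := by
  induction hx, hy using Submodule.span_induction₂ with
  | mem_mem x y hx hy => exact h x hx y hy
  | zero_left y hy => simp
  | zero_right x hx => simp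
  | add_left x y z _ _ _ h₁ h₂ => rw [add_lie]; exact add_mem h₁ h₂
  | add_right x y z _ _ _ h₁ h₂ => rw [lie_add]; exact add_mem h₁ h₂
  | smul_left r x y _ _ h₁ => rw [smul_lie]; exact Submodule.smul_mem _ _ h₁
  | smul_right r x y _ _ h₁ => rw [lie_smul]; exact Submodule.smul_mem _ _ h₁

/-! ### The Lie algebras and the groups -/

/-- The real Lie algebra `𝔧` spanned by `J₁, J₂, J₃`. -/
noncomputable def rotationAlgebra : LieSubalgebra ℝ Mat4 where
  toSubmodule := Submodule.span ℝ {J₁, J₂, J₃}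
  lie_mem' := by
    refine lie_mem_span ?_
    have h₁ : J₁ ∈ Submodule.span ℝ {J₁, J₂, J₃} := Submodule.subset_span (by simp)
    have h₂ : J₂ ∈ Submodule.span ℝ {J₁, J₂, J₃} := Submodule.subset_span (by simp)
    have h₃ : J₃ ∈ Submodule.span ℝ {J₁, J₂, J₃} := Submodule.subset_span (by simp)
    rintro x (rfl | rfl | rfl) y (rfl | rfl | rfl) <;>
      first
      | (rw [lie_self]; exact zero_mem _)
      | simpa [lie_J₁_J₂, lie_J₂_J₃, lie_J₃_J₁]
      | (rw [← lie_skew]; simpa [lie_J₁_J₂, lie_J₂_J₃, lie_J₃_J₁])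

/-- The real Lie algebra `𝔲𝔤 ⊆ 𝔰𝔲(4)` spanned by `J₁, J₂, J₃, K₁, K₂, K₃`. -/
noncomputable def ugAlgebra : LieSubalgebra ℝ Mat4 where
  toSubmodule := Submodule.span ℝ {J₁, J₂, J₃, K₁, K₂, K₃}
  lie_mem' := by
    refine lie_mem_span ?_
    have h₁ : J₁ ∈ Submodule.span ℝ {J₁, J₂, J₃, K₁, K₂, K₃} := Submodule.subset_span (by simp)
    have h₂ : J₂ ∈ Submodule.span ℝ {J₁, J₂, J₃, K₁, K₂, K₃} := Submodule.subset_span (by simp)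
    have h₃ : J₃ ∈ Submodule.span ℝ {J₁, J₂, J₃, K₁, K₂, K₃} := Submodule.subset_span (by simp)
    have h₄ : K₁ ∈ Submodule.span ℝ {J₁, J₂, J₃, K₁, K₂, K₃} := Submodule.subset_span (by simp)
    have h₅ : K₂ ∈ Submodule.span ℝ {J₁, J₂, J₃, K₁, K₂, K₃} := Submodule.subset_span (by simp)
    have h₆ : K₃ ∈ Submodule.span ℝ {J₁, J₂, J₃, K₁, K₂, K₃} := Submodule.subset_span (by simp)
    rintro x (rfl | rfl | rfl | rfl | rfl | rfl) y (rfl | rfl | rfl | rfl | rfl | rfl) <;>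
      first
      | (rw [lie_self]; exact zero_mem _)
      | simp [lie_J₁_J₂, lie_J₂_J₃, lie_J₃_J₁, lie_J₁_K₁, lie_J₁_K₂, lie_J₁_K₃, lie_J₂_K₁,
          lie_J₂_K₂, lie_J₂_K₃, lie_J₃_K₁, lie_J₃_K₂, lie_J₃_K₃, lie_K₁_K₂, lie_K₂_K₃, lie_K₃_K₁,
          h₁, h₂, h₃, h₄, h₅, h₆]
      | (rw [← lie_skew]
         simp [lie_J₁_J₂, lie_J₂_J₃, lie_J₃_J₁, lie_J₁_K₁, lie_J₁_K₂, lie_J₁_K₃, lie_J₂_K₁,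
          lie_J₂_K₂, lie_J₂_K₃, lie_J₃_K₁, lie_J₃_K₂, lie_J₃_K₃, lie_K₁_K₂, lie_K₂_K₃, lie_K₃_K₁,
          h₁, h₂, h₃, h₄, h₅, h₆])

/-- `SU(4)`, with the matrix topology. -/
abbrev SU4 : Type := Matrix.specialUnitaryGroup (Fin 4) ℂ

/-- The connected subgroup of `SU(4)` with Lie algebra `𝔥 ⊆ 𝔰𝔲(4)`: the subgroup generated by
the exponentials of the elements of `𝔥`. -/
def connectedSubgroup (𝔥 : LieSubalgebra ℝ Mat4) : Subgroup SU4 :=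
  Subgroup.closure {U : SU4 | ∃ X ∈ 𝔥, (U : Mat4) = exp X}

/-- The group `UG`: the connected subgroup of `SU(4)` with Lie algebra `𝔲𝔤`, with the topology
induced by the matrix topology. -/
noncomputable def UG : Subgroup SU4 := connectedSubgroup ugAlgebra

/-- The group `SU_J(2)`: the connected subgroup of `SU(4)` with Lie algebra `𝔧`. It consists of the
matrices `exp X` with `X ∈ 𝔧` (`mem_SUJ_iff`). -/
noncomputable def SUJ : Subgroup SU4 := connectedSubgroup rotationAlgebra

/-! ### Consistency of the definitions -/

theorem rotationAlgebra_le_ugAlgebra : rotationAlgebra ≤ ugAlgebra := by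
  intro x hx
  refine Submodule.span_mono ?_ hx
  rintro y (rfl | rfl | rfl) <;> simp

/-- `SU_J(2)` is a subgroup of `UG`. -/
theorem SUJ_le_UG : SUJ ≤ UG := by
  refine Subgroup.closure_mono ?_
  rintro U ⟨X, hX, hU⟩
  exact ⟨X, rotationAlgebra_le_ugAlgebra hX, hU⟩

theorem conjTranspose_of_mem_ug {X : Mat4} (hX : X ∈ ugAlgebra) : X.conjTranspose = -X := by
  induction hX using Submodule.span_induction with
  | mem x hx =>
    rcases hx with rfl | rfl | rfl | rfl | rfl | rfl <;>
      (ext i j; fin_cases i <;> fin_cases j <;> simp [J₁, J₂, J₃, K₁, K₂, K₃])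
  | zero => simp
  | add x y _ _ h₁ h₂ => rw [Matrix.conjTranspose_add, h₁, h₂, neg_add]
  | smul r x _ h₁ => rw [Matrix.conjTranspose_smul, h₁, smul_neg, star_trivial]

/-- A symplectic form preserved by `UG`. -/
def symp : Mat4 := !![0, 0, 0, 1; 0, 0, -1, 0; 0, 1, 0, 0; -1, 0, 0, 0]

theorem symp_mul_transpose : symp * symp.transpose = 1 := by
  ext i j; fin_cases i <;> fin_cases j <;> simp [symp, Matrix.mul_apply, Fin.sum_univ_four]

theorem symp_mul_of_mem_ug {X : Mat4} (hX : X ∈ ugAlgebra) :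
    symp * X = -(X.transpose * symp) := by
  induction hX using Submodule.span_induction with
  | mem x hx =>
    rcases hx with rfl | rfl | rfl | rfl | rfl | rfl <;>
      simp [symp, J₁, J₂, J₃, K₁, K₂, K₃, ← Matrix.ext_iff, Fin.forall_fin_succ,
        Matrix.mul_apply, Fin.sum_univ_four]
  | zero => simp
  | add x y _ _ h₁ h₂ => rw [mul_add, h₁, h₂, Matrix.transpose_add, add_mul, neg_add]
  | smul r x _ h₁ =>
    rw [Matrix.transpose_smul, Matrix.mul_smul, h₁, Matrix.smul_mul, smul_neg]

theorem det_exp_sq {X : Mat4} (hX : X ∈ ugAlgebra) : (exp X).det ^ 2 = 1 := by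
  have hs : IsUnit symp := IsUnit.of_mul_eq_one _ symp_mul_transpose
  have hd : IsUnit symp.det := (Matrix.isUnit_iff_isUnit_det _).1 hs
  have h₁ : X.transpose = symp * (-X) * symp⁻¹ := by
    rw [mul_neg, symp_mul_of_mem_ug hX, neg_neg, mul_assoc, Matrix.mul_nonsing_inv _ hd, mul_one]
  have h₂ : (exp X).det = (exp (-X)).det := by
    rw [← Matrix.det_transpose, ← Matrix.exp_transpose, h₁, Matrix.exp_conj _ _ hs,
      Matrix.det_conj hs]
  have h₃ : exp X * exp (-X) = 1 := by
    rw [← Matrix.exp_add_of_commute _ _ (Commute.refl X).neg_right, add_neg_cancel, exp_zero]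
  have h₄ := congrArg Matrix.det h₃
  rwa [Matrix.det_mul, ← h₂, Matrix.det_one, ← sq] at h₄

/-- The exponential maps `𝔲𝔤` into `SU(4)`. -/
theorem exp_mem_SU4 {X : Mat4} (hX : X ∈ ugAlgebra) :
    exp X ∈ Matrix.specialUnitaryGroup (Fin 4) ℂ := by
  rw [Matrix.mem_specialUnitaryGroup_iff, Matrix.mem_unitaryGroup_iff, Matrix.star_eq_conjTranspose,
    ← Matrix.exp_conjTranspose, conjTranspose_of_mem_ug hX,
    ← Matrix.exp_add_of_commute _ _ (Commute.refl X).neg_right, add_neg_cancel, exp_zero]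
  refine ⟨rfl, ?_⟩
  have h := det_exp_sq (ugAlgebra.smul_mem (1 / 2 : ℝ) hX)
  rw [← Matrix.det_pow, ← Matrix.exp_nsmul, ← Nat.cast_smul_eq_nsmul ℝ, smul_smul] at h
  norm_num at h
  exact h

/-- The matrix realization of the quaternions with `i, j, k ↦ 2J₁, 2J₂, 2J₃`. -/
noncomputable def quatHom : Quaternion ℝ →ₐ[ℝ] Mat4 :=
  QuaternionAlgebra.lift
    { i := (2 : ℝ) • J₁
      j := (2 : ℝ) • J₂
      k := (2 : ℝ) • J₃
      i_mul_i := by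
        ext i j; fin_cases i <;> fin_cases j <;>
          simp [J₁, Matrix.mul_apply, Fin.sum_univ_four]
      j_mul_j := by
        ext i j; fin_cases i <;> fin_cases j <;>
          simp [J₂, Matrix.mul_apply, Fin.sum_univ_four]
      i_mul_j := by
        ext i j; fin_cases i <;> fin_cases j <;>
          simp [J₁, J₂, J₃, Matrix.mul_apply, Fin.sum_univ_four]
      j_mul_i := by
        ext i j; fin_cases i <;> fin_cases j <;>
          simp [J₁, J₂, J₃, Matrix.mul_apply, Fin.sum_univ_four] }

theorem quatHom_apply (q : Quaternion ℝ) : quatHom q =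
    algebraMap ℝ Mat4 q.re + q.imI • (2 : ℝ) • J₁ + q.imJ • (2 : ℝ) • J₂ + q.imK • (2 : ℝ) • J₃ :=
  rfl

theorem quatHom_exp (q : Quaternion ℝ) : quatHom (exp q) = exp (quatHom q) :=
  open scoped Matrix.Norms.Operator in
  letI : NormedAlgebra ℚ (Quaternion ℝ) := .restrictScalars ℚ ℝ _
  map_exp quatHom (LinearMap.continuous_of_finiteDimensional quatHom.toLinearMap) q

theorem exists_quaternion (a b c d : ℝ) :
    ∃ q : Quaternion ℝ, q.re = a ∧ q.imI = b ∧ q.imJ = c ∧ q.imK = d :=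
  ⟨⟨a, b, c, d⟩, rfl, rfl, rfl, rfl⟩

theorem mem_rotationAlgebra_iff {X : Mat4} :
    X ∈ rotationAlgebra ↔ ∃ q : Quaternion ℝ, q.re = 0 ∧ quatHom q = X := by
  change X ∈ Submodule.span ℝ {J₁, J₂, J₃} ↔ _
  rw [Submodule.mem_span_triple]
  constructor
  · rintro ⟨a, b, c, rfl⟩
    obtain ⟨q, h₀, h₁, h₂, h₃⟩ := exists_quaternion 0 (a / 2) (b / 2) (c / 2)
    exact ⟨q, h₀, by simp [quatHom_apply, h₀, h₁, h₂, h₃, smul_smul]⟩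
  · rintro ⟨q, hq, rfl⟩
    exact ⟨q.imI * 2, q.imJ * 2, q.imK * 2, by simp [quatHom_apply, hq, smul_smul]⟩

theorem exists_exp_eq_of_norm_one {u : Quaternion ℝ} (hu : ‖u‖ = 1) :
    ∃ q : Quaternion ℝ, q.re = 0 ∧ exp q = u := by
  have h : u.re ^ 2 + ‖u.im‖ ^ 2 = 1 := by
    have h₁ := Quaternion.normSq_eq_norm_mul_self u
    have h₂ := Quaternion.normSq_eq_norm_mul_self u.im
    rw [Quaternion.normSq_def'] at h₁ h₂
    rw [Quaternion.re_im, Quaternion.imI_im, Quaternion.imJ_im, Quaternion.imK_im] at h₂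
    rw [hu] at h₁
    linarith
  have hcos : Real.cos (Real.arccos u.re) = u.re :=
    Real.cos_arccos (by nlinarith [sq_nonneg ‖u.im‖]) (by nlinarith [sq_nonneg ‖u.im‖])
  have hsin : Real.sin (Real.arccos u.re) = ‖u.im‖ := by
    rw [Real.sin_arccos, show 1 - u.re ^ 2 = ‖u.im‖ ^ 2 by linarith, Real.sqrt_sq (norm_nonneg _)]
  obtain ⟨n, hn, hn₁, hnu⟩ : ∃ n : Quaternion ℝ, n.re = 0 ∧ ‖n‖ = 1 ∧ ‖u.im‖ • n = u.im := by
    obtain hv | hv := eq_or_ne ‖u.im‖ 0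
    · obtain ⟨n, h₀, h₁, h₂, h₃⟩ := exists_quaternion 0 1 0 0
      refine ⟨n, h₀, ?_, by rw [hv, zero_smul, norm_eq_zero.1 hv]⟩
      have h₄ := Quaternion.normSq_eq_norm_mul_self n
      rw [Quaternion.normSq_def', h₀, h₁, h₂, h₃] at h₄
      nlinarith [norm_nonneg n]
    · refine ⟨‖u.im‖⁻¹ • u.im, ?_, ?_, smul_inv_smul₀ hv _⟩
      · rw [Quaternion.re_smul, Quaternion.re_im, smul_zero]
      · rw [norm_smul, norm_inv, norm_norm, inv_mul_cancel₀ hv]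
  refine ⟨Real.arccos u.re • n, ?_, ?_⟩
  · rw [Quaternion.re_smul, hn, smul_zero]
  · rw [Quaternion.exp_of_re_eq_zero _ (by rw [Quaternion.re_smul, hn, smul_zero]), norm_smul, hn₁,
      mul_one, Real.norm_of_nonneg (Real.arccos_nonneg _), hcos, smul_smul]
    have : Real.sin (Real.arccos u.re) / Real.arccos u.re * Real.arccos u.re = ‖u.im‖ := by
      obtain h₀ | h₀ := eq_or_ne (Real.arccos u.re) 0
      · rw [← hsin, h₀]; simp
      · rw [div_mul_cancel₀ _ h₀, hsin]
    rw [this, hnu, Quaternion.re_add_im]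

/-- Every element of `SU_J(2)` is the exponential of a single element of `𝔧`. -/
theorem mem_SUJ_iff {U : SU4} : U ∈ SUJ ↔ ∃ X ∈ rotationAlgebra, (U : Mat4) = exp X := by
  refine ⟨fun hU => ?_, fun hU => Subgroup.subset_closure hU⟩
  induction hU using Subgroup.closure_induction with
  | mem U hU => exact hU
  | one => exact ⟨0, zero_mem _, by simp⟩
  | mul U V _ _ hU hV =>
    obtain ⟨X, hX, hU⟩ := hU
    obtain ⟨Y, hY, hV⟩ := hV
    obtain ⟨p, hp, rfl⟩ := mem_rotationAlgebra_iff.1 hX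
    obtain ⟨q, hq, rfl⟩ := mem_rotationAlgebra_iff.1 hY
    obtain ⟨r, hr, hrr⟩ := exists_exp_eq_of_norm_one (u := exp p * exp q) (by simp [hp, hq])
    refine ⟨quatHom r, mem_rotationAlgebra_iff.2 ⟨r, hr, rfl⟩, ?_⟩
    rw [← quatHom_exp, hrr, map_mul, quatHom_exp, quatHom_exp, ← hU, ← hV]
    rfl
  | inv U _ hU =>
    obtain ⟨X, hX, hU⟩ := hU
    refine ⟨-X, neg_mem hX, ?_⟩
    rw [← conjTranspose_of_mem_ug (rotationAlgebra_le_ugAlgebra hX), Matrix.exp_conjTranspose, ← hU]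
    rfl

end Superspinor

/-! ### Simple connectedness of spheres of dimension at least two. -/

section Sphere

open Metric Set Module
open scoped unitInterval

variable {E : Type*} [NormedAddCommGroup E]

/-! The Lie algebra `𝔲𝔤` is `𝔰𝔲(2) ⊕ 𝔰𝔲(2)` with `𝔧` as its diagonal. The involution `chirality`
commutes with the `Jᵢ` and turns them into the `Kᵢ` up to sign, so its two eigenspaces split the
matrix algebra and give an injective algebra map `quatPairHom` on pairs of quaternions.
Exponentiating, `UG` is `S³ × S³` (`mem_UG_iff`) and `SU_J(2)` is the diagonal `S³`
(`mem_SUJ_iff_quatHom`). Each coset contains exactly one pair `(p, 1)`, so the quotient is `S³`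
(`sphereHomeomorph`).

The sphere is handled by general position: a loop is homotopic to a normalized polynomial curve,
which misses a point because the cone over it has dimension at most two. It then contracts in the
complement of that point, a vector space by stereographic projection. -/

/-- Two paths on the unit sphere which never are at distance one or more are homotopic: normalize
the straight-line homotopy. -/
theorem Path.Homotopic.of_dist_lt_one [NormedSpace ℝ E] {x y : sphere (0 : E) 1} (γ δ : Path x y)
    (f : C(I, E)) (hf : ∀ t, ‖f t - γ t‖ < 1) (hδ : ∀ t, (δ t : E) = ‖f t‖⁻¹ • f t) :
    γ.Homotopic δ := by
  have hx : ‖(x : E)‖ = 1 := norm_eq_of_mem_sphere x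
  let g : I × I → E := fun p => (γ p.2 : E) + (p.1 : ℝ) • (f p.2 - γ p.2)
  have hgc : Continuous g := by fun_prop
  have hg : ∀ p, g p ≠ 0 := by
    intro p h
    -- A zero of `g` would write a unit vector as a multiple, with factor at most one, of a vector
    -- of norm less than one.
    have h₁ : (γ p.2 : E) = -((p.1 : ℝ) • (f p.2 - γ p.2)) := eq_neg_of_add_eq_zero_left h
    have h₂ := congrArg norm h₁
    rw [norm_eq_of_mem_sphere, norm_neg, norm_smul, Real.norm_of_nonneg p.1.2.1] at h₂
    nlinarith [hf p.2, p.1.2.1, p.1.2.2, norm_nonneg (f p.2 - γ p.2)]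
  -- The homotopy must fix endpoints. Where `γ` and `δ` agree, `f t` lies on the ray through `γ t`,
  -- so the whole segment normalizes to `γ t`.
  have hfix : ∀ t, γ t = δ t → ∀ s, ‖g (s, t)‖⁻¹ • g (s, t) = γ t := by
    intro t ht s
    have h₁ : (γ t : E) = ‖f t‖⁻¹ • f t := by rw [ht, hδ]
    have h₂ : f t ≠ 0 := by
      intro h
      have := norm_eq_of_mem_sphere (γ t)
      rw [h₁, h] at this
      simp at this
    have h₃ : f t = ‖f t‖ • (γ t : E) := by
      rw [h₁, smul_inv_smul₀ (norm_ne_zero_iff.2 h₂)]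
    have h₄ : g (s, t) = (1 + (s : ℝ) * (‖f t‖ - 1)) • (γ t : E) := by
      simp only [g]
      rw [h₃, norm_smul, norm_norm, norm_eq_of_mem_sphere, mul_one]
      module
    have h₅ : 0 ≤ 1 + (s : ℝ) * (‖f t‖ - 1) := by
      nlinarith [s.2.1, s.2.2, norm_nonneg (f t)]
    have h₆ : 1 + (s : ℝ) * (‖f t‖ - 1) ≠ 0 := by
      intro h
      exact hg (s, t) (by rw [h₄, h, zero_smul])
    rw [h₄, norm_smul, norm_eq_of_mem_sphere, mul_one, Real.norm_of_nonneg h₅, inv_smul_smul₀ h₆]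
  refine ⟨{
    toFun := fun p => ⟨‖g p‖⁻¹ • g p, ?_⟩
    continuous_toFun := ?_
    map_zero_left := ?_
    map_one_left := ?_
    prop' := ?_ }⟩
  · rw [mem_sphere_zero_iff_norm, norm_smul, norm_inv, norm_norm,
      inv_mul_cancel₀ (norm_ne_zero_iff.2 (hg p))]
  · exact ((hgc.norm.inv₀ fun p => norm_ne_zero_iff.2 (hg p)).smul hgc).subtype_mk _
  · intro t
    ext
    simp [g, norm_eq_of_mem_sphere]
  · intro t
    ext
    simp [g, hδ]
  · rintro s t (rfl | rfl) <;> ext <;> exact hfix _ (by simp) s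

/-- The complement of a point of the unit sphere is simply connected. -/
theorem isSimplyConnected_compl_singleton_sphere [InnerProductSpace ℝ E] (v : sphere (0 : E) 1) :
    IsSimplyConnected ({v}ᶜ : Set (sphere (0 : E) 1)) := by
  have hv : ‖(v : E)‖ = 1 := norm_eq_of_mem_sphere v
  have h := (isOpenEmbedding_stereographic_symm hv).isEmbedding.isSimplyConnected_image (s := univ)
  rw [image_univ, range_stereographic_symm hv (by simp)] at h
  exact h.2 ((Homeomorph.Set.univ _).toHomotopyEquiv.simplyConnectedSpace)

/-- Every path on the unit sphere of a space of dimension at least three is homotopic to a path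
which is not surjective. -/
theorem Path.exists_homotopic_notMem_range_sphere [NormedSpace ℝ E] [FiniteDimensional ℝ E]
    (hE : 2 < finrank ℝ E) {x y : sphere (0 : E) 1} (γ : Path x y) :
    ∃ δ : Path x y, γ.Homotopic δ ∧ ∃ v, ∀ t, δ t ≠ v := by
  let c : C(I, E) := ⟨fun t => γ t, by fun_prop⟩
  -- Degree zero is excluded: that approximation is constant and would miss the endpoint `y`.
  obtain ⟨n, hn₀, hn⟩ := ((Filter.eventually_ne_atTop 0).and
    ((bernsteinApproximation_uniform c).eventually (ball_mem_nhds c one_pos))).exists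
  set f := bernsteinApproximation n c with hfdef
  have hf : ∀ t, ‖f t - γ t‖ < 1 := fun t => by
    rw [← dist_eq_norm]
    exact (ContinuousMap.dist_apply_le_dist t).trans_lt hn
  have hf₀ : ∀ t, f t ≠ 0 := fun t h => by
    have := hf t
    rw [h, zero_sub, norm_neg, norm_eq_of_mem_sphere] at this
    exact lt_irrefl _ this
  have hfx : f 0 = x := by simp [hfdef, c]
  have hfy : f 1 = y := by simp [hfdef, c, hn₀]
  -- The cone over the polynomial curve, with parameter in all of `ℝ`. It is a `C¹` image of the
  -- plane, so its complement is dense when the dimension exceeds two. It contains all multiples of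
  -- each `f t`, so the direction of a missed `w` is missed by the normalized curve.
  let F : ℝ × ℝ → E := fun p => p.1 • ∑ k : Fin (n + 1),
    ((n.choose k : ℝ) * p.2 ^ (k : ℕ) * (1 - p.2) ^ (n - k)) • c (bernstein.z k)
  have hF : ContDiff ℝ 1 F := by
    refine contDiff_fst.smul (ContDiff.sum fun k _ => ContDiff.smul ?_ contDiff_const)
    fun_prop
  have hFf : ∀ (r : ℝ) (t : I), F (r, t) = r • f t := fun r t => by
    simp [F, hfdef, bernsteinApproximation.apply, bernstein_apply]
  obtain ⟨w, hw⟩ := (hF.dense_compl_range_of_finrank_lt_finrank (by simpa using hE)).nonempty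
  have hw₀ : w ≠ 0 := by
    rintro rfl
    exact hw ⟨(0, 0), by simp [F]⟩
  refine ⟨{
    toFun := fun t => ⟨‖f t‖⁻¹ • f t, ?_⟩
    continuous_toFun := ?_
    source' := ?_
    target' := ?_ }, ?_, ⟨‖w‖⁻¹ • w, ?_⟩, ?_⟩
  · rw [mem_sphere_zero_iff_norm, norm_smul, norm_inv, norm_norm,
      inv_mul_cancel₀ (norm_ne_zero_iff.2 (hf₀ t))]
  · have hfc := f.continuous
    exact ((hfc.norm.inv₀ fun p => norm_ne_zero_iff.2 (hf₀ p)).smul hfc).subtype_mk _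
  · ext
    simp [hfx, norm_eq_of_mem_sphere]
  · ext
    simp [hfy, norm_eq_of_mem_sphere]
  · exact Path.Homotopic.of_dist_lt_one _ _ f hf fun t => rfl
  · rw [mem_sphere_zero_iff_norm, norm_smul, norm_inv, norm_norm,
      inv_mul_cancel₀ (norm_ne_zero_iff.2 hw₀)]
  · intro t ht
    have h : ‖f t‖⁻¹ • f t = ‖w‖⁻¹ • w := congrArg Subtype.val ht
    refine hw ⟨(‖w‖ * ‖f t‖⁻¹, t), ?_⟩
    rw [hFf, mul_smul, h, smul_inv_smul₀ (norm_ne_zero_iff.2 hw₀)]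

/-- The unit sphere of a Euclidean space of dimension at least three is simply connected. -/
theorem simplyConnectedSpace_sphere [InnerProductSpace ℝ E] [FiniteDimensional ℝ E]
    (hE : 2 < finrank ℝ E) : SimplyConnectedSpace (sphere (0 : E) 1) := by
  rw [simply_connected_iff_loops_nullhomotopic]
  refine ⟨isPathConnected_iff_pathConnectedSpace.1 (isPathConnected_sphere ?_ 0 zero_le_one), ?_⟩
  · rw [← finrank_eq_rank]
    exact_mod_cast (by omega : 1 < finrank ℝ E)
  · intro x γ
    obtain ⟨δ, hδ, v, hv⟩ := γ.exists_homotopic_notMem_range_sphere hE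
    obtain ⟨F, -⟩ := (isSimplyConnected_iff_exists_homotopy_refl_forall_mem.1
      (isSimplyConnected_compl_singleton_sphere v)).2 x δ hv
    exact hδ.trans ⟨F⟩

end Sphere

namespace Superspinor

attribute [local instance 100] LieRing.ofAssociativeRing

/-! ### The two commuting quaternion actions -/

/-- An involution commuting with `J₁, J₂, J₃` and carrying them to `K₁, -K₂, K₃`. -/
noncomputable def chirality : Mat4 :=
  !![0, 0, Complex.I, 0; 0, 0, 0, Complex.I; -Complex.I, 0, 0, 0; 0, -Complex.I, 0, 0]

theorem chirality_mul_self : chirality * chirality = 1 := by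
  ext i j; fin_cases i <;> fin_cases j <;>
    simp [chirality, Matrix.mul_apply, Fin.sum_univ_four]

theorem chirality_mul_J₁ : chirality * J₁ = K₁ := by
  ext i j; fin_cases i <;> fin_cases j <;>
    simp [chirality, J₁, K₁, Matrix.mul_apply, Fin.sum_univ_four, mul_comm]

theorem chirality_mul_J₂ : chirality * J₂ = -K₂ := by
  ext i j; fin_cases i <;> fin_cases j <;>
    simp [chirality, J₂, K₂, Matrix.mul_apply, Fin.sum_univ_four, mul_left_comm Complex.I]

theorem chirality_mul_J₃ : chirality * J₃ = K₃ := by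
  ext i j; fin_cases i <;> fin_cases j <;>
    simp [chirality, J₃, K₃, Matrix.mul_apply, Fin.sum_univ_four, mul_left_comm Complex.I]

theorem commute_chirality_J₁ : Commute chirality J₁ := by
  ext i j; fin_cases i <;> fin_cases j <;>
    simp [chirality, J₁, Matrix.mul_apply, Fin.sum_univ_four, mul_comm]

theorem commute_chirality_J₂ : Commute chirality J₂ := by
  ext i j; fin_cases i <;> fin_cases j <;>
    simp [chirality, J₂, Matrix.mul_apply, Fin.sum_univ_four, mul_left_comm Complex.I,
      mul_assoc]

theorem commute_chirality_J₃ : Commute chirality J₃ := by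
  ext i j; fin_cases i <;> fin_cases j <;>
    simp [chirality, J₃, Matrix.mul_apply, Fin.sum_univ_four, mul_left_comm Complex.I,
      mul_assoc]

theorem commute_chirality_quatHom (q : Quaternion ℝ) : Commute chirality (quatHom q) := by
  rw [quatHom_apply]
  exact ((((Algebra.commute_algebraMap_right _ _).add_right
    ((commute_chirality_J₁.smul_right _).smul_right _)).add_right
    ((commute_chirality_J₂.smul_right _).smul_right _)).add_right
    ((commute_chirality_J₃.smul_right _).smul_right _))

/-- The projection to the `+1` eigenspace of `chirality`. -/
noncomputable def leftProj : Mat4 := (1 / 2 : ℝ) • (1 + chirality)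

/-- The projection to the `-1` eigenspace of `chirality`. -/
noncomputable def rightProj : Mat4 := (1 / 2 : ℝ) • (1 - chirality)

theorem leftProj_mul_self : leftProj * leftProj = leftProj := by
  rw [leftProj, smul_mul_smul_comm, add_mul, mul_add, mul_add, chirality_mul_self, one_mul, one_mul,
    mul_one]
  module

theorem rightProj_mul_self : rightProj * rightProj = rightProj := by
  rw [rightProj, smul_mul_smul_comm, sub_mul, mul_sub, mul_sub, chirality_mul_self, one_mul,
    one_mul, mul_one]
  module

theorem leftProj_mul_rightProj : leftProj * rightProj = 0 := by
  rw [leftProj, rightProj, smul_mul_smul_comm, add_mul, mul_sub, mul_sub, chirality_mul_self,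
    one_mul, one_mul, mul_one]
  module

theorem rightProj_mul_leftProj : rightProj * leftProj = 0 := by
  rw [leftProj, rightProj, smul_mul_smul_comm, sub_mul, mul_add, mul_add, chirality_mul_self,
    one_mul, one_mul, mul_one]
  module

theorem leftProj_add_rightProj : leftProj + rightProj = 1 := by
  rw [leftProj, rightProj]
  module

theorem leftProj_ne_zero : leftProj ≠ 0 := fun h => by
  simpa [leftProj, chirality] using congrFun₂ h 0 0

theorem rightProj_ne_zero : rightProj ≠ 0 := fun h => by
  simpa [rightProj, chirality] using congrFun₂ h 0 0

theorem commute_leftProj_quatHom (q : Quaternion ℝ) : Commute leftProj (quatHom q) :=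
  ((Commute.one_left _).add_left (commute_chirality_quatHom q)).smul_left _

theorem commute_rightProj_quatHom (q : Quaternion ℝ) : Commute rightProj (quatHom q) :=
  ((Commute.one_left _).sub_left (commute_chirality_quatHom q)).smul_left _

/-- The action of a pair of quaternions, the first one acting on the `+1` eigenspace of `chirality`
and the second one on the `-1` eigenspace. -/
noncomputable def quatPairHom : Quaternion ℝ × Quaternion ℝ →ₐ[ℝ] Mat4 where
  toFun p := quatHom p.1 * leftProj + quatHom p.2 * rightProj
  map_one' := by simp [leftProj_add_rightProj]
  map_zero' := by simp
  map_add' p q := by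
    simp only [Prod.fst_add, Prod.snd_add, map_add, add_mul]
    abel
  map_mul' p q := by
    -- Moving the projections past quaternions lets idempotence and orthogonality kill the cross
    -- terms.
    have h₁ (A B : Mat4) (r : Quaternion ℝ) :
        (A * leftProj) * (quatHom r * B) = A * quatHom r * (leftProj * B) := by
      rw [mul_assoc, ← mul_assoc leftProj, (commute_leftProj_quatHom r).eq]
      simp only [mul_assoc]
    have h₂ (A B : Mat4) (r : Quaternion ℝ) :
        (A * rightProj) * (quatHom r * B) = A * quatHom r * (rightProj * B) := by
      rw [mul_assoc, ← mul_assoc rightProj, (commute_rightProj_quatHom r).eq]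
      simp only [mul_assoc]
    rw [add_mul, mul_add, mul_add, h₁, h₁, h₂, h₂, leftProj_mul_self, leftProj_mul_rightProj,
      rightProj_mul_leftProj, rightProj_mul_self]
    simp
  commutes' r := by
    simp only [Prod.algebraMap_apply, AlgHom.commutes]
    rw [← mul_add, leftProj_add_rightProj, mul_one]

theorem quatPairHom_apply (p : Quaternion ℝ × Quaternion ℝ) :
    quatPairHom p = quatHom p.1 * leftProj + quatHom p.2 * rightProj := rfl

theorem quatPairHom_diag (q : Quaternion ℝ) : quatPairHom (q, q) = quatHom q := by
  rw [quatPairHom_apply, ← mul_add, leftProj_add_rightProj, mul_one]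

theorem continuous_quatPairHom : Continuous quatPairHom :=
  LinearMap.continuous_of_finiteDimensional quatPairHom.toLinearMap

theorem quatPairHom_exp (p : Quaternion ℝ × Quaternion ℝ) :
    quatPairHom (exp p.1, exp p.2) = exp (quatPairHom p) :=
  open scoped Matrix.Norms.Operator in
  letI : NormedAlgebra ℚ (Quaternion ℝ) := .restrictScalars ℚ ℝ _
  letI : NormedAlgebra ℚ (Quaternion ℝ × Quaternion ℝ) := .restrictScalars ℚ ℝ _
  (congrArg quatPairHom (Prod.ext (Prod.fst_exp p).symm (Prod.snd_exp p).symm)).trans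
    (map_exp quatPairHom continuous_quatPairHom p)

/-- A nonzero quaternion is invertible, hence so is its matrix. -/
theorem eq_zero_of_quatHom_mul_eq_zero {q : Quaternion ℝ} {A : Mat4} (hA : A ≠ 0)
    (h : quatHom q * A = 0) : q = 0 := by
  by_contra hq
  refine hA ?_
  rw [← one_mul A, ← map_one quatHom, ← inv_mul_cancel₀ hq, map_mul, mul_assoc, h, mul_zero]

/-- Right multiplication by `leftProj` isolates the first component. -/
theorem fst_eq_of_quatPairHom_eq {p q p' q' : Quaternion ℝ}
    (h : quatPairHom (p, q) = quatPairHom (p', q')) : p = p' := by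
  refine sub_eq_zero.1 (eq_zero_of_quatHom_mul_eq_zero leftProj_ne_zero ?_)
  have : quatPairHom ((p, q) - (p', q')) * leftProj = 0 := by
    rw [map_sub, sub_eq_zero.2 h, zero_mul]
  simpa [-map_sub, quatPairHom_apply, add_mul, mul_assoc, leftProj_mul_self,
    rightProj_mul_leftProj] using this

theorem snd_eq_of_quatPairHom_eq {p q p' q' : Quaternion ℝ}
    (h : quatPairHom (p, q) = quatPairHom (p', q')) : q = q' := by
  refine sub_eq_zero.1 (eq_zero_of_quatHom_mul_eq_zero rightProj_ne_zero ?_)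
  have : quatPairHom ((p, q) - (p', q')) * rightProj = 0 := by
    rw [map_sub, sub_eq_zero.2 h, zero_mul]
  simpa [-map_sub, quatPairHom_apply, add_mul, mul_assoc, rightProj_mul_self,
    leftProj_mul_rightProj] using this

/-- `chirality` is `+1` on the image of `leftProj` and `-1` on that of `rightProj`. -/
theorem chirality_mul_quatHom (q : Quaternion ℝ) : chirality * quatHom q = quatPairHom (q, -q) := by
  rw [(commute_chirality_quatHom q).eq, quatPairHom_apply, map_neg, neg_mul, ← sub_eq_add_neg,
    ← mul_sub]
  congr 1
  rw [leftProj, rightProj]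
  module

/-- The splitting `𝔲𝔤 = 𝔰𝔲(2) ⊕ 𝔰𝔲(2)`: the `Jᵢ` come from diagonal pairs `(q, q)` and the `Kᵢ` from
antidiagonal pairs `(q, -q)`. Conversely, any pair is the sum of its diagonal half-sum and
antidiagonal half-difference. -/
theorem mem_ugAlgebra_iff {X : Mat4} :
    X ∈ ugAlgebra ↔ ∃ p : Quaternion ℝ × Quaternion ℝ, p.1.re = 0 ∧ p.2.re = 0 ∧
      quatPairHom p = X := by
  constructor
  · intro hX
    have hJ {Y : Mat4} (hY : Y ∈ rotationAlgebra) : ∃ p : Quaternion ℝ × Quaternion ℝ,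
        p.1.re = 0 ∧ p.2.re = 0 ∧ quatPairHom p = Y := by
      obtain ⟨q, hq, rfl⟩ := mem_rotationAlgebra_iff.1 hY
      exact ⟨(q, q), hq, hq, quatPairHom_diag q⟩
    have hK {Y : Mat4} (hY : Y ∈ rotationAlgebra) : ∃ p : Quaternion ℝ × Quaternion ℝ,
        p.1.re = 0 ∧ p.2.re = 0 ∧ quatPairHom p = chirality * Y := by
      obtain ⟨q, hq, rfl⟩ := mem_rotationAlgebra_iff.1 hY
      exact ⟨(q, -q), hq, by simp [hq], (chirality_mul_quatHom q).symm⟩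
    have h₁ : J₁ ∈ rotationAlgebra := Submodule.subset_span (by simp)
    have h₂ : J₂ ∈ rotationAlgebra := Submodule.subset_span (by simp)
    have h₃ : J₃ ∈ rotationAlgebra := Submodule.subset_span (by simp)
    induction hX using Submodule.span_induction with
    | mem x hx =>
      rcases hx with rfl | rfl | rfl | rfl | rfl | rfl
      · exact hJ h₁
      · exact hJ h₂
      · exact hJ h₃
      · exact chirality_mul_J₁ ▸ hK h₁
      · have := hK (neg_mem h₂)
        rwa [mul_neg, chirality_mul_J₂, neg_neg] at this
      · exact chirality_mul_J₃ ▸ hK h₃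
    | zero => exact ⟨0, rfl, rfl, map_zero _⟩
    | add x y _ _ hx hy =>
      obtain ⟨p, hp₁, hp₂, rfl⟩ := hx
      obtain ⟨q, hq₁, hq₂, rfl⟩ := hy
      exact ⟨p + q, by simp [hp₁, hq₁], by simp [hp₂, hq₂], map_add _ _ _⟩
    | smul r x _ hx =>
      obtain ⟨p, hp₁, hp₂, rfl⟩ := hx
      exact ⟨r • p, by simp [hp₁], by simp [hp₂], map_smul _ _ _⟩
  · rintro ⟨⟨p, q⟩, hp, hq, rfl⟩
    replace hp : p.re = 0 := hp
    replace hq : q.re = 0 := hq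
    have hJ {r : Quaternion ℝ} (hr : r.re = 0) : quatHom r ∈ ugAlgebra :=
      rotationAlgebra_le_ugAlgebra (mem_rotationAlgebra_iff.2 ⟨r, hr, rfl⟩)
    have hK {r : Quaternion ℝ} (hr : r.re = 0) : chirality * quatHom r ∈ ugAlgebra := by
      have h₁ : K₁ ∈ ugAlgebra := Submodule.subset_span (by simp)
      have h₂ : K₂ ∈ ugAlgebra := Submodule.subset_span (by simp)
      have h₃ : K₃ ∈ ugAlgebra := Submodule.subset_span (by simp)
      have : chirality * quatHom r =
          r.imI • (2 : ℝ) • K₁ + r.imJ • (2 : ℝ) • -K₂ + r.imK • (2 : ℝ) • K₃ := by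
        rw [quatHom_apply, hr, map_zero, zero_add, mul_add, mul_add]
        simp only [mul_smul_comm, chirality_mul_J₁, chirality_mul_J₂, chirality_mul_J₃]
      rw [this]
      exact add_mem (add_mem (ugAlgebra.smul_mem _ (ugAlgebra.smul_mem _ h₁))
        (ugAlgebra.smul_mem _ (ugAlgebra.smul_mem _ (neg_mem h₂))))
        (ugAlgebra.smul_mem _ (ugAlgebra.smul_mem _ h₃))
    have h : (p, q) = ((1 / 2 : ℝ) • (p + q), (1 / 2 : ℝ) • (p + q)) +
        ((1 / 2 : ℝ) • (p - q), -((1 / 2 : ℝ) • (p - q))) := by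
      ext1
      · simp only [Prod.fst_add]; module
      · simp only [Prod.snd_add]; module
    rw [h, map_add, quatPairHom_diag, ← chirality_mul_quatHom]
    exact add_mem (hJ (by simp [hp, hq])) (hK (by simp [hp, hq]))

/-! ### The groups in terms of unit quaternions -/

theorem norm_exp_eq_one {q : Quaternion ℝ} (hq : q.re = 0) : ‖exp q‖ = 1 := by
  simp [hq]

/-- `UG` is the group of pairs of unit quaternions. -/
theorem mem_UG_iff {U : SU4} : U ∈ UG ↔
    ∃ p q : Quaternion ℝ, ‖p‖ = 1 ∧ ‖q‖ = 1 ∧ (U : Mat4) = quatPairHom (p, q) := by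
  constructor
  · intro hU
    induction hU using Subgroup.closure_induction with
    | mem U hU =>
      obtain ⟨X, hX, hU⟩ := hU
      obtain ⟨p, hp₁, hp₂, rfl⟩ := mem_ugAlgebra_iff.1 hX
      exact ⟨exp p.1, exp p.2, norm_exp_eq_one hp₁, norm_exp_eq_one hp₂,
        hU.trans (quatPairHom_exp p).symm⟩
    | one => exact ⟨1, 1, norm_one, norm_one, (map_one quatPairHom).symm⟩
    | mul U V _ _ hU hV =>
      obtain ⟨p, q, hp, hq, hU⟩ := hU
      obtain ⟨p', q', hp', hq', hV⟩ := hV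
      refine ⟨p * p', q * q', by simp [hp, hp'], by simp [hq, hq'], ?_⟩
      rw [← Prod.mk_mul_mk, map_mul, ← hU, ← hV]
      rfl
    | inv U _ hU =>
      obtain ⟨p, q, hp, hq, hU⟩ := hU
      refine ⟨p⁻¹, q⁻¹, by simp [hp], by simp [hq], ?_⟩
      have hp₀ : p ≠ 0 := by rintro rfl; simp at hp
      have hq₀ : q ≠ 0 := by rintro rfl; simp at hq
      have h₁ : quatPairHom (p⁻¹, q⁻¹) * (U : Mat4) = 1 := by
        rw [hU, ← map_mul, Prod.mk_mul_mk, inv_mul_cancel₀ hp₀, inv_mul_cancel₀ hq₀]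
        exact map_one quatPairHom
      have h₂ : (U : Mat4) * ((U⁻¹ : SU4) : Mat4) = 1 := congrArg Subtype.val (mul_inv_cancel U)
      exact (left_inv_eq_right_inv h₁ h₂).symm
  · rintro ⟨p, q, hp, hq, hU⟩
    -- The exponential is onto the unit quaternions in each factor, so a single generator already
    -- suffices.
    obtain ⟨a, ha, rfl⟩ := exists_exp_eq_of_norm_one hp
    obtain ⟨b, hb, rfl⟩ := exists_exp_eq_of_norm_one hq
    exact Subgroup.subset_closure ⟨quatPairHom (a, b), mem_ugAlgebra_iff.2 ⟨(a, b), ha, hb, rfl⟩,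
      hU.trans (quatPairHom_exp (a, b))⟩

/-- Writing the pair as one exponential avoids computing a determinant. -/
theorem quatPairHom_mem_SU4 {p q : Quaternion ℝ} (hp : ‖p‖ = 1) (hq : ‖q‖ = 1) :
    quatPairHom (p, q) ∈ Matrix.specialUnitaryGroup (Fin 4) ℂ := by
  obtain ⟨a, ha, rfl⟩ := exists_exp_eq_of_norm_one hp
  obtain ⟨b, hb, rfl⟩ := exists_exp_eq_of_norm_one hq
  rw [quatPairHom_exp (a, b)]
  exact exp_mem_SU4 (mem_ugAlgebra_iff.2 ⟨(a, b), ha, hb, rfl⟩)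

/-- `SU_J(2)` is the group of unit quaternions. -/
theorem mem_SUJ_iff_quatHom {U : SU4} :
    U ∈ SUJ ↔ ∃ q : Quaternion ℝ, ‖q‖ = 1 ∧ (U : Mat4) = quatHom q := by
  rw [mem_SUJ_iff]
  constructor
  · rintro ⟨X, hX, hU⟩
    obtain ⟨q, hq, rfl⟩ := mem_rotationAlgebra_iff.1 hX
    exact ⟨exp q, norm_exp_eq_one hq, hU.trans (quatHom_exp q).symm⟩
  · rintro ⟨q, hq, hU⟩
    obtain ⟨a, ha, rfl⟩ := exists_exp_eq_of_norm_one hq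
    exact ⟨quatHom a, mem_rotationAlgebra_iff.2 ⟨a, ha, rfl⟩, hU.trans (quatHom_exp a)⟩

theorem isClosed_SUJ : IsClosed (SUJ : Set SU4) := by
  have h : (SUJ : Set SU4) = Subtype.val ⁻¹' (quatHom '' Metric.sphere 0 1) := by
    ext U
    simp only [SetLike.mem_coe, mem_SUJ_iff_quatHom, Set.mem_preimage, Set.mem_image,
      mem_sphere_zero_iff_norm, eq_comm (a := (U : Mat4))]
  rw [h]
  have hc : Continuous quatHom := LinearMap.continuous_of_finiteDimensional quatHom.toLinearMap
  exact ((isCompact_sphere 0 1).image hc).isClosed.preimage continuous_subtype_val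

instance : IsTopologicalGroup SU4 where
  continuous_inv := (continuous_star.comp continuous_subtype_val).subtype_mk _

/-- Closedness makes the quotient Hausdorff, as `sphereHomeomorph` requires. -/
instance : IsClosed ((SUJ.subgroupOf UG : Subgroup UG) : Set UG) :=
  isClosed_SUJ.preimage continuous_subtype_val

/-! ### The homogeneous space -/

/-- The pair `(p, 1)`, for a unit quaternion `p`, as an element of `UG`. -/
noncomputable def leftUnit (p : Metric.sphere (0 : Quaternion ℝ) 1) : UG :=
  ⟨⟨quatPairHom (p, 1), quatPairHom_mem_SU4 (norm_eq_of_mem_sphere p) norm_one⟩,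
    mem_UG_iff.2 ⟨p, 1, norm_eq_of_mem_sphere p, norm_one, rfl⟩⟩

theorem continuous_leftUnit : Continuous leftUnit :=
  ((continuous_quatPairHom.comp (by fun_prop)).subtype_mk _).subtype_mk _

/-- The coset of `(p, 1)` by the diagonal consists of the products `(p, 1)(q, q) = (pq, q)`. -/
theorem leftUnit_mk_eq_mk_iff (p : Metric.sphere (0 : Quaternion ℝ) 1) (U : UG) :
    (leftUnit p : UG ⧸ SUJ.subgroupOf UG) = U ↔ ∃ q : Quaternion ℝ, ‖q‖ = 1 ∧
      ((U : SU4) : Mat4) = quatPairHom (p * q, q) := by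
  have h (A : Mat4) : ((((leftUnit p)⁻¹ * U : UG) : SU4) : Mat4) = A ↔
      ((U : SU4) : Mat4) = quatPairHom (p, 1) * A := by
    have h₁ : quatPairHom (p, 1) * ((((leftUnit p)⁻¹ : UG) : SU4) : Mat4) = 1 :=
      congrArg (fun V : UG => ((V : SU4) : Mat4)) (mul_inv_cancel (leftUnit p))
    have h₂ : ((((leftUnit p)⁻¹ : UG) : SU4) : Mat4) * quatPairHom (p, 1) = 1 :=
      congrArg (fun V : UG => ((V : SU4) : Mat4)) (inv_mul_cancel (leftUnit p))
    change ((((leftUnit p)⁻¹ : UG) : SU4) : Mat4) * ((U : SU4) : Mat4) = A ↔ _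
    constructor
    · rintro rfl
      rw [← mul_assoc, h₁, one_mul]
    · intro hU
      rw [hU, ← mul_assoc, h₂, one_mul]
  rw [QuotientGroup.eq, Subgroup.mem_subgroupOf, mem_SUJ_iff_quatHom]
  refine exists_congr fun q => and_congr_right fun _ => ?_
  rw [h, ← quatPairHom_diag, ← map_mul, Prod.mk_mul_mk, one_mul]

/-- Since `(p, q) = (pq⁻¹, 1)(q, q)`, every coset meets the first factor; comparing second
components forces `q = 1`, so it does so only once. -/
theorem bijective_leftUnit_mk :
    Function.Bijective fun p => (leftUnit p : UG ⧸ SUJ.subgroupOf UG) := by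
  constructor
  · intro p p' h
    obtain ⟨q, -, hq⟩ := (leftUnit_mk_eq_mk_iff p (leftUnit p')).1 h
    have hq : quatPairHom (p', 1) = quatPairHom (p * q, q) := hq
    have h₁ : q = 1 := (snd_eq_of_quatPairHom_eq hq).symm
    rw [h₁, mul_one] at hq
    exact Subtype.ext (fst_eq_of_quatPairHom_eq hq).symm
  · intro x
    obtain ⟨U, rfl⟩ := QuotientGroup.mk_surjective x
    obtain ⟨p, q, hp, hq, hU⟩ := mem_UG_iff.1 U.2
    have hq₀ : q ≠ 0 := by rintro rfl; simp at hq
    refine ⟨⟨p * q⁻¹, by simp [hp, hq]⟩, (leftUnit_mk_eq_mk_iff _ U).2 ⟨q, hq, ?_⟩⟩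
    rw [hU, inv_mul_cancel_right₀ hq₀]

/-- The homogeneous space `UG / SU_J(2)` is the three-dimensional sphere. -/
noncomputable def sphereHomeomorph :
    Metric.sphere (0 : Quaternion ℝ) 1 ≃ₜ UG ⧸ SUJ.subgroupOf UG :=
  -- A continuous bijection from a compact space to a Hausdorff one has a continuous inverse.
  (continuous_quotient_mk'.comp continuous_leftUnit).homeoOfEquivCompactToT2
    (f := Equiv.ofBijective _ bijective_leftUnit_mk)

end Superspinor

theorem mainTheorem6 :
    SimplyConnectedSpace (Superspinor.UG ⧸ Superspinor.SUJ.subgroupOf Superspinor.UG) := by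
  have := simplyConnectedSpace_sphere (E := Quaternion ℝ)
    (by rw [Quaternion.finrank_eq_four]; norm_num)
  exact Superspinor.sphereHomeomorph.symm.toHomotopyEquiv.simplyConnectedSpace
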